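/- Let $\mathrm{Simp}(\mathrm{Grp})$ be the category of simplicial groups. For a simplicial group $X$ let $M=N(X)$ be its Moore complex: $M_0=X_0$, $M_k=\bigcap_{i=0}^{k-1}\ker(d_i\colon X_k\to X_{k-1})$ for $k\ge 1$, with differential $\delta_k\colon M_k\to M_{k-1}$ the restriction of $d_k$. For $n\in\mathbb N$ let $\mathcal M_{n\ge}$ be the full subcategory of simplicial groups $X$ with $N(X)_k=0$ for all $k>n$. Let $Cot_n\colon \mathrm{Simp}(\mathrm{Grp})\to\mathrm{Simp}(\mathrm{Grp})$ be Porter's cotruncation functor: $Cot_n(X)$ is obtained from $X$ by removing, in the semidirect decomposition of each $X_m$ into the factors $s_\sigma(M_k)$ ($\sigma\colon[m]\to[k]$ a monotone surjection, $s_\sigma\colon X_k\to X_m$ the corresponding degeneracy operator), all factors with $k>n$, and by replacing the factors $s_\sigma(M_n)$ by $s_\sigma(M_n/\delta_{n+1}(M_{n+1}))$; that is, $Cot_n(X)_m$ is the quotient of $X_m$ by the normal subgroup generated by the subgroups $s_\sigma(M_k)$ with $k>n$ and $s_\sigma(\delta_{n+1}(M_{n+1}))$. Let $\eta_X\colon X\to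 Cot_n(X)$ be the quotient map, and let $\mathrm{Ker}(Cot_n)$ be the full subcategory of all $X$ with $Cot_n(X)\cong 0$. Then for every $n\in\mathbb N$ the pair $$\mu_{n\ge}=(\mathrm{Ker}(Cot_n),\ \mathcal M_{n\ge})$$ is a torsion theory in $\mathrm{Simp}(\mathrm{Grp})$: both subcategories are full and replete, every morphism $T\to F$ with $T\in\mathrm{Ker}(Cot_n)$ and $F\in\mathcal M_{n\ge}$ is zero, and for every simplicial group $X$ there is a short exact sequence $0\to T_X\to X\to F_X\to 0$ (the first map is a kernel of the second and the second is a cokernel of the first) with $T_X\in\mathrm{Ker}(Cot_n)$ and $F_X\in\mathcal M_{n\ge}$. In particular $\mathcal M_{n\ge}$ is a torsion-free subcategory of $\mathrm{Simp}(\mathrm{Grp})$. Moreover, $Cot_n$ is a normal reflector onto $\mathcal M_{n\ge}$: it takes values in $\mathcal M_{n\ge}$, as a functor to $\mathcal M_{n\ge}$ it is left adjoint to the inclusion with unit $\eta$, every $\eta_X$ is a normal epimorphism, and $Cot_n(\ker\eta_X)\cong 0$ for every simplicial group $X$. -/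

import Mathlib

open CategoryTheory CategoryTheory.Limits Opposite
open scoped Simplicial

universe v u

/-- The trivial homomorphisms are the zero morphisms of the category of groups. -/
instance grpHasZeroMorphisms : HasZeroMorphisms GrpCat.{u} where
  zero G H := ⟨GrpCat.ofHom 1⟩
  comp_zero f Z := by
    apply GrpCat.hom_ext
    ext x
    rfl
  zero_comp W X Y f := by
    apply GrpCat.hom_ext
    ext x
    exact map_one f.hom

/-- Simplicial groups form a functor category, with the levelwise zero morphisms. -/
instance simpGrpHasZeroMorphisms : HasZeroMorphisms (SimplicialObject GrpCat.{u}) :=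
  inferInstanceAs (HasZeroMorphisms (SimplexCategoryᵒᵖ ⥤ GrpCat.{u}))

/-- `0 ⟶ K ⟶ X ⟶ Q ⟶ 0` is short exact: `k` is the kernel of `p` and `p` is the cokernel of `k`. -/
def IsShortExactSeq {C : Type u} [Category.{v} C] [HasZeroMorphisms C] {K X Q : C}
    (k : K ⟶ X) (p : X ⟶ Q) : Prop :=
  ∃ w : k ≫ p = 0,
    Nonempty (IsLimit (KernelFork.ofι k w)) ∧ Nonempty (IsColimit (CokernelCofork.ofπ p w))

/-- A torsion theory `(T, F)`: two full replete subcategories such that every morphism from an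
object of `T` to an object of `F` is zero, and every object is an extension of an object of `F`
by an object of `T`. -/
structure IsTorsionTheory {C : Type u} [Category.{v} C] [HasZeroMorphisms C]
    (T F : ObjectProperty C) : Prop where
  torsion_replete : T.IsClosedUnderIsomorphisms
  torsionFree_replete : F.IsClosedUnderIsomorphisms
  hom_eq_zero : ∀ {A B : C}, T A → F B → ∀ f : A ⟶ B, f = 0
  exists_shortExact : ∀ X : C, ∃ (A B : C) (k : A ⟶ X) (p : X ⟶ B),
    T A ∧ F B ∧ IsShortExactSeq k p

/-- The kernel of a functor: the objects that it sends to a zero object. -/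
def functorKernel {C D : Type*} [Category* C] [Category* D] (G : C ⥤ D) : ObjectProperty C :=
  fun X => IsZero (G.obj X)

namespace SimplicialGroup

/-- The group `N(X)_k` of the Moore complex: `N(X)_0 = X_0`, and `N(X)_k` is the intersection of the
kernels of the faces `d_0, …, d_{k-1} : X_k ⟶ X_{k-1}` (all faces but the last). -/
def moore (X : SimplicialObject GrpCat.{u}) (k : ℕ) : Subgroup (X.obj (op ⦋k⦌)) :=
  match k with
  | 0 => ⊤
  | k + 1 => ⨅ i : Fin (k + 1), (X.δ i.castSucc).hom.ker

/-- The image in `X_k` of the Moore differential `N(X)_{k+1} ⟶ N(X)_k`, the restriction of the last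
face `d_{k+1}`. -/
def mooreBoundary (X : SimplicialObject GrpCat.{u}) (k : ℕ) : Subgroup (X.obj (op ⦋k⦌)) :=
  (moore X (k + 1)).map (X.δ (Fin.last (k + 1))).hom

/-- The simplicial groups whose Moore complex is trivial in all degrees greater than `n`. -/
def mooreTruncated (n : ℕ) : ObjectProperty (SimplicialObject GrpCat.{u}) :=
  fun X => ∀ k : ℕ, n < k → moore X k = ⊥

/-- The part of the Moore complex `M` in degree `k` that is killed by the cotruncation
`0 ⟶ M_n / d(M_{n+1}) ⟶ M_{n-1} ⟶ ⋯ ⟶ M_0`: nothing for `k < n`, the boundaries `d(M_{n+1})` for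
`k = n`, and all of `M_k` for `k > n`. -/
def killed (n : ℕ) (X : SimplicialObject GrpCat.{u}) (k : ℕ) : Subgroup (X.obj (op ⦋k⦌)) :=
  if k < n then ⊥ else if k = n then mooreBoundary X k else moore X k

/-- The copies of the killed parts of the Moore complex among the factors `s_σ(M_k)` of the
semidirect decomposition of `X_m`; here `σ` runs over all surjections `[m] ⟶ [k]`. -/
def killedFactors (n : ℕ) (X : SimplicialObject GrpCat.{u}) (m : SimplexCategoryᵒᵖ) :
    Set (X.obj m) :=
  {y | ∃ (k : ℕ) (σ : m.unop ⟶ ⦋k⦌), Epi σ ∧ ∃ x ∈ killed n X k, (X.map σ.op).hom x = y}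

/-- The normal subgroup of `X_m` that is divided out in the cotruncation. -/
def cotKernel (n : ℕ) (X : SimplicialObject GrpCat.{u}) (m : SimplexCategoryᵒᵖ) :
    Subgroup (X.obj m) :=
  Subgroup.normalClosure (killedFactors n X m)

instance cotKernel_normal (n : ℕ) (X : SimplicialObject GrpCat.{u}) (m : SimplexCategoryᵒᵖ) :
    (cotKernel n X m).Normal :=
  Subgroup.normalClosure_normal

theorem face_of_mem_moore (X : SimplicialObject GrpCat.{u}) {k : ℕ} {x : X.obj (op ⦋k + 1⦌)}
    (hx : x ∈ moore X (k + 1)) (i : Fin (k + 1)) : (X.δ i.castSucc).hom x = 1 :=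
  (Subgroup.mem_iInf.1 hx) i

theorem face_boundary (X : SimplicialObject GrpCat.{u}) {k : ℕ} {x : X.obj (op ⦋k + 1 + 1⦌)}
    (hx : x ∈ moore X (k + 1 + 1)) (i : Fin (k + 2)) :
    (X.δ i).hom ((X.δ (Fin.last (k + 2))).hom x) = 1 := by
  have h := X.δ_comp_δ (Fin.le_last i)
  have h' := congrArg (fun f => f.hom x) h
  simp only [GrpCat.hom_comp, MonoidHom.comp_apply, Fin.succ_last] at h'
  refine h'.trans ?_
  rw [face_of_mem_moore X hx i, map_one]

theorem boundary_mem_moore (X : SimplicialObject GrpCat.{u}) {k : ℕ} {x : X.obj (op ⦋k + 1⦌)}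
    (hx : x ∈ moore X (k + 1)) : (X.δ (Fin.last (k + 1))).hom x ∈ moore X k := by
  cases k with
  | zero => exact Subgroup.mem_top _
  | succ k => exact Subgroup.mem_iInf.2 fun i => face_boundary X hx i.castSucc

theorem face_mem_killed (n : ℕ) (X : SimplicialObject GrpCat.{u}) {k : ℕ}
    {x : X.obj (op ⦋k + 1⦌)} (hx : x ∈ killed n X (k + 1)) (j : Fin (k + 2)) :
    (X.δ j).hom x ∈ killed n X k := by
  unfold killed at hx
  split_ifs at hx with h1 h2
  · rw [Subgroup.mem_bot.1 hx, map_one]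
    exact one_mem _
  · obtain ⟨y, hy, rfl⟩ := hx
    have := face_boundary X hy j
    rw [this]
    exact one_mem _
  · induction j using Fin.lastCases with
    | cast i =>
      rw [face_of_mem_moore X hx i]
      exact one_mem _
    | last =>
      unfold killed
      split_ifs with h3 h4
      · omega
      · exact ⟨x, hx, rfl⟩
      · exact boundary_mem_moore X hx

theorem mono_mem_killed (n : ℕ) (X : SimplicialObject GrpCat.{u}) (m : ℕ) :
    ∀ (k : ℕ) (ι : ⦋m⦌ ⟶ ⦋k⦌), Mono ι → ∀ x ∈ killed n X k, (X.map ι.op).hom x ∈ killed n X m := by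
  intro k
  induction k with
  | zero =>
    intro ι hι x hx
    obtain rfl : m = 0 := Nat.le_zero.1 (SimplexCategory.le_of_mono ι)
    rw [SimplexCategory.eq_id_of_mono ι]
    simpa using hx
  | succ k ih =>
    intro ι hι x hx
    by_cases hm : m = k + 1
    · subst hm
      rw [SimplexCategory.eq_id_of_mono ι]
      simpa using hx
    · have hns : ¬ Function.Surjective ι.toOrderHom := by
        intro hs
        have : Epi ι := SimplexCategory.epi_iff_surjective.2 hs
        have := SimplexCategory.le_of_epi ι
        have := SimplexCategory.le_of_mono ι
        omega
      obtain ⟨j, θ, rfl⟩ := SimplexCategory.eq_comp_δ_of_not_surjective ι hns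
      have hθ : Mono θ := mono_of_mono θ (SimplexCategory.δ j)
      have := ih θ hθ _ (face_mem_killed n X hx j)
      simpa [SimplicialObject.δ] using this

theorem map_mem_cotKernel (n : ℕ) (X : SimplicialObject GrpCat.{u}) {a b : SimplexCategoryᵒᵖ}
    (f : a ⟶ b) : cotKernel n X a ≤ (cotKernel n X b).comap (X.map f).hom := by
  refine Subgroup.normalClosure_le_normal ?_
  rintro _ ⟨k, σ, hσ, x, hx, rfl⟩
  refine Subgroup.subset_normalClosure
    ⟨(image (f.unop ≫ σ)).len, factorThruImage (f.unop ≫ σ), inferInstance,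
      (X.map (image.ι (f.unop ≫ σ)).op).hom x, ?_, ?_⟩
  · exact mono_mem_killed n X _ k (image.ι (f.unop ≫ σ)) inferInstance x hx
  · have h : (image.ι (f.unop ≫ σ)).op ≫ (factorThruImage (f.unop ≫ σ)).op = σ.op ≫ f := by
      rw [← op_comp, image.fac, op_comp, Quiver.Hom.op_unop]
    have h' := congrArg (fun g => (X.map g).hom x) h
    simpa only [Functor.map_comp, GrpCat.hom_comp, MonoidHom.comp_apply] using h'

theorem app_mem_moore {X Y : SimplicialObject GrpCat.{u}} (f : X ⟶ Y) {k : ℕ}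
    {x : X.obj (op ⦋k⦌)} (hx : x ∈ moore X k) : (f.app (op ⦋k⦌)).hom x ∈ moore Y k := by
  cases k with
  | zero => exact Subgroup.mem_top _
  | succ k =>
    refine Subgroup.mem_iInf.2 fun i => ?_
    have h := congrArg (fun g => g.hom x) (f.naturality (SimplexCategory.δ i.castSucc).op)
    simp only [GrpCat.hom_comp, MonoidHom.comp_apply] at h
    refine (MonoidHom.mem_ker).2 (h.symm.trans ?_)
    have := face_of_mem_moore X hx i
    simp only [SimplicialObject.δ] at this
    rw [this, map_one]

theorem app_mem_killed (n : ℕ) {X Y : SimplicialObject GrpCat.{u}} (f : X ⟶ Y) {k : ℕ}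
    {x : X.obj (op ⦋k⦌)} (hx : x ∈ killed n X k) : (f.app (op ⦋k⦌)).hom x ∈ killed n Y k := by
  unfold killed at hx ⊢
  split_ifs at hx ⊢ with h1 h2
  · rw [Subgroup.mem_bot.1 hx, map_one]
    exact one_mem _
  · obtain ⟨y, hy, rfl⟩ := hx
    refine ⟨_, app_mem_moore f hy, ?_⟩
    have h := congrArg (fun g => g.hom y) (f.naturality (SimplexCategory.δ (Fin.last (k + 1))).op)
    exact h.symm
  · exact app_mem_moore f hx

theorem app_mem_cotKernel (n : ℕ) {X Y : SimplicialObject GrpCat.{u}} (f : X ⟶ Y)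
    (m : SimplexCategoryᵒᵖ) : cotKernel n X m ≤ (cotKernel n Y m).comap (f.app m).hom := by
  refine Subgroup.normalClosure_le_normal ?_
  rintro _ ⟨k, σ, hσ, x, hx, rfl⟩
  refine Subgroup.subset_normalClosure ⟨k, σ, hσ, _, app_mem_killed n f hx, ?_⟩
  have h := congrArg (fun g => g.hom x) (f.naturality σ.op)
  exact h.symm

/-- The cotruncation of a simplicial group `X`: in level `m` the quotient of `X_m` by the killed
factors of its semidirect decomposition. -/
def cotObj (n : ℕ) (X : SimplicialObject GrpCat.{u}) : SimplicialObject GrpCat.{u} where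
  obj m := GrpCat.of (X.obj m ⧸ cotKernel n X m)
  map {a b} f := GrpCat.ofHom (QuotientGroup.map _ _ (X.map f).hom (map_mem_cotKernel n X f))
  map_id a := by
    apply GrpCat.hom_ext
    apply QuotientGroup.monoidHom_ext
    ext x
    simp
  map_comp f g := by
    apply GrpCat.hom_ext
    apply QuotientGroup.monoidHom_ext
    ext x
    simp

/-- The cotruncation functor `Cot_n` on simplicial groups. -/
def cot (n : ℕ) : SimplicialObject GrpCat.{u} ⥤ SimplicialObject GrpCat.{u} where
  obj X := cotObj n X
  map {X Y} f :=
    { app := fun m =>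
        GrpCat.ofHom (QuotientGroup.map _ _ (f.app m).hom (app_mem_cotKernel n f m))
      naturality := fun a b g => by
        apply GrpCat.hom_ext
        apply QuotientGroup.monoidHom_ext
        ext x
        have h := congrArg (fun t => t.hom x) (f.naturality g)
        exact congrArg (QuotientGroup.mk' (cotKernel n Y b)) h }
  map_id X := by
    apply NatTrans.ext
    funext m
    apply GrpCat.hom_ext
    apply QuotientGroup.monoidHom_ext
    ext x
    rfl
  map_comp f g := by
    apply NatTrans.ext
    funext m
    apply GrpCat.hom_ext
    apply QuotientGroup.monoidHom_ext
    ext x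
    rfl

/-- The levelwise quotient map `X ⟶ Cot_n(X)`. -/
def cotProj (n : ℕ) (X : SimplicialObject GrpCat.{u}) : X ⟶ (cot n).obj X where
  app m := GrpCat.ofHom (QuotientGroup.mk' (cotKernel n X m))
  naturality a b f := by
    apply GrpCat.hom_ext
    ext x
    rfl

end SimplicialGroup

namespace SimplicialGroup

/-! The corrections `x ↦ x * (s_j d_j x)⁻¹`, applied for `j = 0, 1, …`, push any element of positive
degree into the Moore complex. This has two consequences. A levelwise surjection is surjective on
Moore complexes, so `Cot_n(X)` has no Moore elements above degree `n`. And a subobject closed under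
degeneracies that contains every Moore element is everything.

If `N(Y)` vanishes above `n`, nothing in `Y` is killed; since killed elements are preserved by
morphisms, each `X ⟶ Y` factors through `Cot_n(X)`, and is zero when `Cot_n(X)` is zero.

For the kernel `K` of `X ⟶ Cot_n(X)`, the complex `N(K)` is zero below `n`, consists of boundaries
from `N(K)` itself in degree `n`, and lies above `n` otherwise. All of it is therefore killed, and
since it generates `K` under degeneracies, `Cot_n(K)` is zero. -/

theorem map_apply_app {X Y : SimplicialObject GrpCat.{u}} (f : X ⟶ Y) {a b : SimplexCategoryᵒᵖ}
    (g : a ⟶ b) (x : X.obj a) :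
    (f.app b).hom ((X.map g).hom x) = (Y.map g).hom ((f.app a).hom x) :=
  congrArg (fun t => t.hom x) (f.naturality g)

theorem hom_ext_apply {X Y : SimplicialObject GrpCat.{u}} {f g : X ⟶ Y}
    (h : ∀ (m : SimplexCategoryᵒᵖ) (x : X.obj m), (f.app m).hom x = (g.app m).hom x) : f = g := by
  apply NatTrans.ext
  funext m
  apply GrpCat.hom_ext
  ext x
  exact h m x

/-! ### Pushing elements into the Moore complex -/

theorem face_degeneracy_self (X : SimplicialObject GrpCat.{u}) {k : ℕ} (j : Fin (k + 1))
    (y : X.obj (op ⦋k⦌)) : (X.δ j.castSucc).hom ((X.σ j).hom y) = y :=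
  congrArg (fun t => t.hom y) (X.δ_comp_σ_self (i := j))

/-- For `i < j`, `d_i s_j d_j = s_{j-1} d_i d_j = s_{j-1} d_{j-1} d_i`. Hence correcting at `j` does
not spoil an earlier face that is already trivial. -/
theorem face_degeneracy_face_of_lt (X : SimplicialObject GrpCat.{u}) {k : ℕ} {i j : Fin (k + 1)}
    (hij : i < j) {x : X.obj (op ⦋k + 1⦌)} (hx : (X.δ i.castSucc).hom x = 1) :
    (X.δ i.castSucc).hom ((X.σ j).hom ((X.δ j.castSucc).hom x)) = 1 := by
  obtain ⟨k, rfl⟩ : ∃ l, k = l + 1 := ⟨k - 1, by omega⟩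
  obtain ⟨j, rfl⟩ := Fin.eq_succ_of_ne_zero (Fin.ne_zero_of_lt hij)
  obtain ⟨i, rfl⟩ : ∃ l : Fin (k + 1), i = l.castSucc :=
    ⟨i.castLT (by have := j.isLt; have : i.val < j.val + 1 := hij; omega), rfl⟩
  have hle : i ≤ j := by
    have : i.val < j.val + 1 := hij
    exact Fin.le_def.2 (by omega)
  have h1 := congrArg (fun t => t.hom ((X.δ j.succ.castSucc).hom x))
    (X.δ_comp_σ_of_le (i := i.castSucc) (j := j) (Fin.castSucc_le_castSucc_iff.2 hle))
  have h2 := congrArg (fun t => t.hom x)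
    (X.δ_comp_δ (i := i.castSucc) (j := j.castSucc) (Fin.castSucc_le_castSucc_iff.2 hle))
  simp only [GrpCat.hom_comp, MonoidHom.comp_apply, Fin.succ_castSucc] at h1 h2
  refine h1.trans ?_
  rw [h2, hx, map_one, map_one]

/-- A property that is stable under the corrections `x ↦ x * (s_j d_j x)⁻¹` and holds for some
element holds for some element of the Moore complex. -/
theorem exists_mem_moore_of_stable (X : SimplicialObject GrpCat.{u}) {k : ℕ}
    (P : X.obj (op ⦋k + 1⦌) → Prop)
    (hP : ∀ x (j : Fin (k + 1)), P x → P (x * ((X.σ j).hom ((X.δ j.castSucc).hom x))⁻¹))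
    (x : X.obj (op ⦋k + 1⦌)) (hx : P x) : ∃ y ∈ moore X (k + 1), P y := by
  -- After corrections at `0, …, l - 1` the first `l` faces are trivial.
  have key : ∀ l : ℕ, l ≤ k + 1 →
      ∃ y, (∀ i : Fin (k + 1), i.val < l → (X.δ i.castSucc).hom y = 1) ∧ P y := by
    intro l
    induction l with
    | zero => exact fun _ => ⟨x, fun i hi => absurd hi (Nat.not_lt_zero _), hx⟩
    | succ l ih =>
      intro hl
      obtain ⟨y, hy, hPy⟩ := ih (by omega)
      refine ⟨_, fun i hi => ?_, hP y ⟨l, hl⟩ hPy⟩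
      rw [map_mul, map_inv]
      rcases Nat.lt_succ_iff_lt_or_eq.1 hi with hlt | heq
      · rw [hy i hlt, face_degeneracy_face_of_lt X (j := ⟨l, hl⟩) hlt (hy i hlt), inv_one, mul_one]
      · obtain rfl : i = ⟨l, hl⟩ := Fin.ext heq
        rw [face_degeneracy_self, mul_inv_cancel]
  obtain ⟨y, hy, hPy⟩ := key (k + 1) le_rfl
  exact ⟨y, Subgroup.mem_iInf.2 fun i => hy i i.isLt, hPy⟩

/-- A levelwise surjective morphism is surjective on Moore complexes. -/
theorem exists_mem_moore_of_app_surjective {X Y : SimplicialObject GrpCat.{u}} (f : X ⟶ Y) {k : ℕ}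
    (hf : Function.Surjective (f.app (op ⦋k⦌)).hom) {y : Y.obj (op ⦋k⦌)} (hy : y ∈ moore Y k) :
    ∃ x ∈ moore X k, (f.app (op ⦋k⦌)).hom x = y := by
  obtain ⟨x, hx⟩ := hf y
  cases k with
  | zero => exact ⟨x, Subgroup.mem_top _, hx⟩
  | succ k =>
    -- Corrections do not change the image: it is multiplied by a degeneracy of `d_j y`, which is
    -- trivial.
    refine exists_mem_moore_of_stable X (fun z => (f.app (op ⦋k + 1⦌)).hom z = y) ?_ x hx
    intro z j hz
    have h1 := map_apply_app f (SimplexCategory.σ j).op ((X.δ j.castSucc).hom z)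
    have h2 := map_apply_app f (SimplexCategory.δ j.castSucc).op z
    have h3 := face_of_mem_moore Y hy j
    simp only [SimplicialObject.δ, SimplicialObject.σ] at h1 h3 ⊢
    rw [map_mul, map_inv, h1, h2, hz, h3, map_one, inv_one, mul_one]

/-- A simplicial group is generated by the degeneracies of its Moore complex. -/
theorem eq_top_of_moore_le (X : SimplicialObject GrpCat.{u}) (H : ∀ k, Subgroup (X.obj (op ⦋k⦌)))
    (hσ : ∀ k (j : Fin (k + 1)), ∀ x ∈ H k, (X.σ j).hom x ∈ H (k + 1))
    (hH : ∀ k, moore X k ≤ H k) (k : ℕ) : H k = ⊤ := by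
  induction k with
  | zero => exact top_le_iff.1 (hH 0)
  | succ k ih =>
    refine (Subgroup.eq_top_iff' _).2 fun x => ?_
    -- The stable property is the implication `z ∈ H → x ∈ H`, which holds trivially at `z = x`. A
    -- correction changes `z` by a degeneracy from the level below, where `H` is everything.
    have hstep : ∀ z (j : Fin (k + 1)), (z ∈ H (k + 1) → x ∈ H (k + 1)) →
        z * ((X.σ j).hom ((X.δ j.castSucc).hom z))⁻¹ ∈ H (k + 1) → x ∈ H (k + 1) := by
      intro z j hz hz'
      refine hz ((Subgroup.mul_mem_cancel_right _ (Subgroup.inv_mem _ ?_)).1 hz')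
      exact hσ k j _ (ih ▸ Subgroup.mem_top _)
    obtain ⟨y, hy, hyx⟩ := exists_mem_moore_of_stable X _ hstep x id
    exact hyx (hH _ hy)

/-! ### The divided-out subgroup, degree by degree -/

instance moore_normal (X : SimplicialObject GrpCat.{u}) (k : ℕ) : (moore X k).Normal := by
  cases k with
  | zero => exact Subgroup.normal_top
  | succ k => exact Subgroup.normal_iInf_normal fun i => inferInstance

/-- The last face is split by the last degeneracy, so it is surjective and carries normal subgroups
to normal subgroups. -/
instance mooreBoundary_normal (X : SimplicialObject GrpCat.{u}) (k : ℕ) :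
    (mooreBoundary X k).Normal :=
  (moore_normal X (k + 1)).map _ fun x =>
    ⟨(X.σ (Fin.last k)).hom x,
      congrArg (fun t => t.hom x) (X.δ_comp_σ_succ' (Fin.succ_last k).symm)⟩

theorem moore_le_cotKernel (n : ℕ) (X : SimplicialObject GrpCat.{u}) {k : ℕ} (hk : n < k) :
    moore X k ≤ cotKernel n X (op ⦋k⦌) := by
  intro x hx
  refine Subgroup.subset_normalClosure ⟨k, 𝟙 _, inferInstance, x, ?_, by simp⟩
  rwa [killed, if_neg (by omega), if_neg (by omega)]

theorem cotKernel_eq_bot_of_lt {n k : ℕ} (X : SimplicialObject GrpCat.{u}) (hk : k < n) :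
    cotKernel n X (op ⦋k⦌) = ⊥ := by
  refine Subgroup.normalClosure_eq_bot_iff.2 ?_
  rintro _ ⟨l, σ, hσ, x, hx, rfl⟩
  have hl : l ≤ k := SimplexCategory.le_of_epi σ
  rw [killed, if_pos (by omega), Subgroup.mem_bot] at hx
  rw [hx, map_one]
  rfl

/-- In degree `n` only the identity surjection contributes, and the boundaries are already normal,
so taking the normal closure adds nothing. -/
theorem cotKernel_le_mooreBoundary (n : ℕ) (X : SimplicialObject GrpCat.{u}) :
    cotKernel n X (op ⦋n⦌) ≤ mooreBoundary X n := by
  refine Subgroup.normalClosure_le_normal ?_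
  rintro _ ⟨l, σ, hσ, x, hx, rfl⟩
  have hl : l ≤ n := SimplexCategory.le_of_epi σ
  rcases hl.lt_or_eq with hlt | rfl
  · rw [killed, if_pos hlt, Subgroup.mem_bot] at hx
    rw [hx, map_one]
    exact one_mem _
  · rw [killed, if_neg (lt_irrefl _), if_pos rfl] at hx
    rw [SimplexCategory.eq_id_of_epi σ]
    simpa using hx

theorem cotProj_surjective (n : ℕ) (X : SimplicialObject GrpCat.{u}) (m : SimplexCategoryᵒᵖ) :
    Function.Surjective ((cotProj n X).app m).hom :=
  QuotientGroup.mk'_surjective _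

theorem cotProj_eq_one_iff (n : ℕ) (X : SimplicialObject GrpCat.{u}) {m : SimplexCategoryᵒᵖ}
    (x : X.obj m) : ((cotProj n X).app m).hom x = 1 ↔ x ∈ cotKernel n X m :=
  QuotientGroup.eq_one_iff x

/-! ### Cotruncations, truncated objects and orthogonality -/

theorem mooreTruncated_cot (n : ℕ) (X : SimplicialObject GrpCat.{u}) :
    mooreTruncated n ((cot n).obj X) := by
  intro k hk
  refine (Subgroup.eq_bot_iff_forall _).2 fun y hy => ?_
  obtain ⟨x, hx, rfl⟩ :=
    exists_mem_moore_of_app_surjective (cotProj n X) (cotProj_surjective n X _) hy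
  exact (cotProj_eq_one_iff n X x).2 (moore_le_cotKernel n X hk hx)

theorem cotKernel_eq_bot {n : ℕ} {X : SimplicialObject GrpCat.{u}} (hX : mooreTruncated n X)
    (m : SimplexCategoryᵒᵖ) : cotKernel n X m = ⊥ := by
  refine Subgroup.normalClosure_eq_bot_iff.2 ?_
  rintro _ ⟨l, σ, hσ, x, hx, rfl⟩
  have : killed n X l = ⊥ := by
    unfold killed
    split_ifs with h1 h2
    · rfl
    · rw [mooreBoundary, hX (l + 1) (by omega), Subgroup.map_bot]
    · exact hX l (by omega)
  rw [this, Subgroup.mem_bot] at hx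
  rw [hx, map_one]
  rfl

theorem mooreTruncated_isClosedUnderIsomorphisms (n : ℕ) :
    (mooreTruncated.{u} n).IsClosedUnderIsomorphisms where
  of_iso {X Y} e hX k hk := by
    refine (Subgroup.eq_bot_iff_forall _).2 fun y hy => ?_
    have h := app_mem_moore e.inv hy
    rw [hX k hk, Subgroup.mem_bot] at h
    have h' := congrArg (fun t => (t.app (op ⦋k⦌)).hom y) e.inv_hom_id
    simp only [NatTrans.comp_app, GrpCat.hom_comp, MonoidHom.comp_apply] at h'
    rw [h, map_one] at h'
    exact h'.symm

theorem isZero_cot_iff (n : ℕ) (X : SimplicialObject GrpCat.{u}) :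
    IsZero ((cot n).obj X) ↔ ∀ m, cotKernel n X m = ⊤ := by
  refine (Functor.isZero_iff (C := SimplexCategoryᵒᵖ) (D := GrpCat.{u}) _).trans
    (forall_congr' fun m => ?_)
  refine GrpCat.isZero_iff_subsingleton.trans ?_
  exact QuotientGroup.subsingleton_iff

theorem functorKernel_isClosedUnderIsomorphisms {C D : Type*} [Category* C] [Category* D]
    (G : C ⥤ D) : (functorKernel G).IsClosedUnderIsomorphisms where
  of_iso e hX := IsZero.of_iso hX (G.mapIso e.symm)

theorem eq_zero_of_cotKernel {n : ℕ} {X Y : SimplicialObject GrpCat.{u}}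
    (hX : IsZero ((cot n).obj X)) (hY : mooreTruncated n Y) (f : X ⟶ Y) : f = 0 := by
  refine hom_ext_apply fun m x => ?_
  have hx : x ∈ cotKernel n X m := (isZero_cot_iff n X).1 hX m ▸ Subgroup.mem_top _
  have h := app_mem_cotKernel n f m hx
  rw [cotKernel_eq_bot hY] at h
  exact Subgroup.mem_bot.1 h

/-! ### The kernel of the quotient map is torsion -/

/-- The kernel of `X ⟶ Cot_n(X)`. -/
def cotKernelObj (n : ℕ) (X : SimplicialObject GrpCat.{u}) : SimplicialObject GrpCat.{u} where
  obj m := GrpCat.of (cotKernel n X m)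
  map {a b} f := GrpCat.ofHom (((X.map f).hom.comp (cotKernel n X a).subtype).codRestrict
    (cotKernel n X b) fun x => map_mem_cotKernel n X f x.2)
  map_id a := by
    apply GrpCat.hom_ext
    ext x
    simp
  map_comp f g := by
    apply GrpCat.hom_ext
    ext x
    exact congrArg (fun t => t.hom x.1) (X.map_comp f g)

/-- The inclusion of the kernel of `X ⟶ Cot_n(X)`. -/
def cotKernelι (n : ℕ) (X : SimplicialObject GrpCat.{u}) : cotKernelObj n X ⟶ X where
  app m := GrpCat.ofHom (cotKernel n X m).subtype
  naturality a b f := by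
    apply GrpCat.hom_ext
    ext x
    rfl

theorem mem_moore_cotKernelObj (n : ℕ) (X : SimplicialObject GrpCat.{u}) {k : ℕ}
    (x : cotKernel n X (op ⦋k⦌)) (hx : (x : X.obj (op ⦋k⦌)) ∈ moore X k) :
    x ∈ moore (cotKernelObj n X) k := by
  cases k with
  | zero => exact Subgroup.mem_top _
  | succ k => exact Subgroup.mem_iInf.2 fun i => Subtype.ext (face_of_mem_moore X hx i)

/-- The only delicate degree is `n`, where a boundary in `X` must be a boundary in the kernel
itself. -/
theorem moore_cotKernelObj_le_killed (n : ℕ) (X : SimplicialObject GrpCat.{u}) (k : ℕ) :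
    moore (cotKernelObj n X) k ≤ killed n (cotKernelObj n X) k := by
  intro x hx
  unfold killed
  split_ifs with h1 h2
  · have hx' : (x : cotKernel n X (op ⦋k⦌)).1 ∈ cotKernel n X (op ⦋k⦌) := x.2
    have hbot := (cotKernel_eq_bot_of_lt X h1).le hx'
    exact Subtype.ext (Subgroup.mem_bot.1 hbot)
  · subst h2
    obtain ⟨z, hz, hzx⟩ := cotKernel_le_mooreBoundary k X x.2
    -- The bounding element has degree `n + 1`, so it is itself killed and lies in the kernel.
    exact ⟨⟨z, moore_le_cotKernel k X (Nat.lt_succ_self k) hz⟩,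
      mem_moore_cotKernelObj k X _ hz, Subtype.ext hzx⟩
  · exact hx

theorem isZero_cot_cotKernelObj (n : ℕ) (X : SimplicialObject GrpCat.{u}) :
    IsZero ((cot n).obj (cotKernelObj n X)) := by
  refine (isZero_cot_iff n _).2 fun m => ?_
  refine eq_top_of_moore_le (cotKernelObj n X) (fun k => cotKernel n (cotKernelObj n X) (op ⦋k⦌))
    (fun k j x hx => map_mem_cotKernel n _ _ hx) (fun k x hx => ?_) m.unop.len
  exact Subgroup.subset_normalClosure
    ⟨k, 𝟙 _, inferInstance, x, moore_cotKernelObj_le_killed n X k hx, by simp⟩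

/-! ### Universal properties: short exactness and the adjunction -/

/-- A morphism that kills the kernel of `X ⟶ Cot_n(X)` factors through `Cot_n(X)`. -/
def cotDesc (n : ℕ) {X Y : SimplicialObject GrpCat.{u}} (f : X ⟶ Y)
    (hf : ∀ m, cotKernel n X m ≤ (f.app m).hom.ker) : (cot n).obj X ⟶ Y where
  app m := GrpCat.ofHom (QuotientGroup.lift _ (f.app m).hom (hf m))
  naturality a b g := by
    apply GrpCat.hom_ext
    apply QuotientGroup.monoidHom_ext
    ext x
    exact map_apply_app f g x

theorem cotProj_cotDesc (n : ℕ) {X Y : SimplicialObject GrpCat.{u}} (f : X ⟶ Y)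
    (hf : ∀ m, cotKernel n X m ≤ (f.app m).hom.ker) : cotProj n X ≫ cotDesc n f hf = f :=
  hom_ext_apply fun _ _ => rfl

theorem cotProj_cancel (n : ℕ) {X Y : SimplicialObject GrpCat.{u}} {f g : (cot n).obj X ⟶ Y}
    (h : cotProj n X ≫ f = cotProj n X ≫ g) : f = g := by
  refine hom_ext_apply fun m y => ?_
  obtain ⟨x, rfl⟩ := cotProj_surjective n X m y
  exact congrArg (fun t => (t.app m).hom x) h

theorem cotKernel_le_ker_of_mooreTruncated {n : ℕ} {X Y : SimplicialObject GrpCat.{u}}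
    (hY : mooreTruncated n Y) (f : X ⟶ Y) (m : SimplexCategoryᵒᵖ) :
    cotKernel n X m ≤ (f.app m).hom.ker := by
  have h := app_mem_cotKernel n f m
  rwa [cotKernel_eq_bot hY] at h

/-- A morphism that becomes trivial in `Cot_n(X)` factors through the kernel. -/
def cotKernelLift (n : ℕ) {X Y : SimplicialObject GrpCat.{u}} (f : Y ⟶ X)
    (hf : f ≫ cotProj n X = 0) : Y ⟶ cotKernelObj n X where
  app m := GrpCat.ofHom ((f.app m).hom.codRestrict (cotKernel n X m) fun y =>
    (cotProj_eq_one_iff n X _).1 (congrArg (fun t => (t.app m).hom y) hf))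
  naturality a b g := by
    apply GrpCat.hom_ext
    ext x
    exact Subtype.ext (map_apply_app f g x)

theorem isShortExactSeq_cot (n : ℕ) (X : SimplicialObject GrpCat.{u}) :
    IsShortExactSeq (cotKernelι n X) (cotProj n X) := by
  refine ⟨hom_ext_apply fun m x => (cotProj_eq_one_iff n X _).2 x.2, ⟨?_⟩, ⟨?_⟩⟩
  · refine KernelFork.IsLimit.ofι _ _ (fun g hg => cotKernelLift n g hg)
      (fun g hg => hom_ext_apply fun _ _ => rfl) (fun g hg k hk => ?_)
    exact hom_ext_apply fun m x => Subtype.ext (congrArg (fun t => (t.app m).hom x) hk)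
  · refine CokernelCofork.IsColimit.ofπ _ _
      (fun g hg => cotDesc n g fun m x hx =>
        congrArg (fun t : cotKernelObj n X ⟶ _ => (t.app m).hom ⟨x, hx⟩) hg)
      (fun g hg => cotProj_cotDesc n g _) (fun g hg k hk =>
        cotProj_cancel n (hk.trans (cotProj_cotDesc n g _).symm))

/-- `Cot_n` is left adjoint to the inclusion of the simplicial groups with trivial Moore complex
above degree `n`. -/
def cotAdjunction (n : ℕ) :
    (mooreTruncated.{u} n).lift (cot n) (mooreTruncated_cot n) ⊣ (mooreTruncated.{u} n).ι :=
  Adjunction.mkOfHomEquiv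
    { homEquiv := fun X Y =>
        { toFun := fun f => cotProj n X ≫ f.hom
          invFun := fun g =>
            ObjectProperty.homMk (cotDesc n g (cotKernel_le_ker_of_mooreTruncated Y.property g))
          left_inv := fun f => by
            apply ObjectProperty.hom_ext
            exact cotProj_cancel n (cotProj_cotDesc n _ _)
          right_inv := fun g => cotProj_cotDesc n g _ }
      homEquiv_naturality_left_symm := fun f g => by
        apply ObjectProperty.hom_ext
        exact hom_ext_apply fun m y => by
          obtain ⟨x, rfl⟩ := cotProj_surjective n _ m y
          rfl
      homEquiv_naturality_right := fun f g => rfl }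

theorem cotAdjunction_unit_app (n : ℕ) (X : SimplicialObject GrpCat.{u}) :
    (cotAdjunction n).unit.app X = cotProj n X := by
  rw [← Adjunction.homEquiv_id, cotAdjunction, Adjunction.mkOfHomEquiv_homEquiv]
  exact hom_ext_apply fun _ _ => rfl

end SimplicialGroup

open SimplicialGroup in
theorem mainTheorem1 (n : ℕ) :
    IsTorsionTheory (functorKernel (SimplicialGroup.cot.{u} n))
        (SimplicialGroup.mooreTruncated.{u} n) ∧
    ∃ (h : ∀ X, SimplicialGroup.mooreTruncated.{u} n ((SimplicialGroup.cot n).obj X))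
      (adj : (SimplicialGroup.mooreTruncated.{u} n).lift (SimplicialGroup.cot n) h ⊣
        (SimplicialGroup.mooreTruncated.{u} n).ι),
      ∀ X : SimplicialObject GrpCat.{u},
        adj.unit.app X = SimplicialGroup.cotProj n X ∧
        Nonempty (NormalEpi (SimplicialGroup.cotProj n X)) ∧
        ∃ (K : SimplicialObject GrpCat.{u}) (k : K ⟶ X),
          IsShortExactSeq k (SimplicialGroup.cotProj n X) ∧
          IsZero ((SimplicialGroup.cot n).obj K) := by
  refine ⟨⟨functorKernel_isClosedUnderIsomorphisms _, mooreTruncated_isClosedUnderIsomorphisms n,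
    fun hA hB f => eq_zero_of_cotKernel hA hB f, fun X => ⟨cotKernelObj n X, (cot n).obj X,
      cotKernelι n X, cotProj n X, isZero_cot_cotKernelObj n X, mooreTruncated_cot n X,
      isShortExactSeq_cot n X⟩⟩, mooreTruncated_cot n, cotAdjunction n, fun X =>
    ⟨cotAdjunction_unit_app n X, ?_, cotKernelObj n X, cotKernelι n X, isShortExactSeq_cot n X,
      isZero_cot_cotKernelObj n X⟩⟩
  obtain ⟨w, -, ⟨hc⟩⟩ := isShortExactSeq_cot n X
  exact ⟨⟨_, cotKernelι n X, w, hc⟩⟩
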